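/- Let $\alpha,\sigma,t>0$. Consider the Ornstein--Uhlenbeck process $dX_t=-\alpha X_t\,dt+dW_t$ on $\mathbb R$, whose Markov transition kernel is $$\rho_t(x,dy)=\sqrt{\tfrac{c_t}{\pi}}\,\exp\big[-c_t\,(y-e^{-\alpha t}x)^2\big]\,dy,\qquad c_t=\frac{\alpha}{1-e^{-2\alpha t}},$$ and its Koopman operator $(K^t\psi)(x)=\int\psi(y)\,\rho_t(x,dy)$. Let $\mathbb H_\sigma$ be the reproducing kernel Hilbert space, over the scalar field $\mathbb K\in\{\mathbb R,\mathbb C\}$, generated by the Gaussian kernel $k^\sigma(x,y)=\exp[-(x-y)^2/\sigma^2]$ on $\mathbb R$. Then $K^t$ restricts to a bounded linear operator $K^t_\sigma:=K^t|_{\mathbb H_\sigma}:\mathbb H_\sigma\to\mathbb H_\sigma$; that is, for every $\psi\in\mathbb H_\sigma$ and $x\in\mathbb R$ the function $\psi$ is $\rho_t(x,\cdot)$-integrable and $(K^t_\sigma\psi)(x)=\int\psi(y)\,\rho_t(x,dy)$. The operator $K^t_\sigma$ has no eigenvalue in $\mathbb K$, it is not compact, and it is not self-adjoint. -/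

import Mathlib

open MeasureTheory

noncomputable section

/-- The constant `c_t = α / (1 - e^{-2αt})`. -/
def ouPrecision (α t : ℝ) : ℝ := α / (1 - Real.exp (-2 * α * t))

/-- The Markov transition probability `ρ_t(x, ·)`, for `t > 0`, of the Ornstein-Uhlenbeck process
`dX_t = -α X_t dt + dW_t` on `ℝ`: the measure with Lebesgue density
`y ↦ √(c_t / π) exp(-c_t (y - e^{-αt} x)²)`. -/
def ouTransition (α t x : ℝ) : Measure ℝ :=
  volume.withDensity fun y =>
    ENNReal.ofReal (Real.sqrt (ouPrecision α t / Real.pi) *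
      Real.exp (-ouPrecision α t * (y - Real.exp (-α * t) * x) ^ 2))

/-- The Koopman operator of the Ornstein-Uhlenbeck process acting on functions:
`(K^t ψ)(x) = E[ψ(X_t) | X_0 = x] = ∫ ψ(y) ρ_t(x, dy)`. -/
def ouKoopman {𝕜 : Type*} [RCLike 𝕜] (α t : ℝ) (ψ : ℝ → 𝕜) (x : ℝ) : 𝕜 :=
  ∫ y, ψ y ∂(ouTransition α t x)

/-- The Gaussian kernel `k^σ(x, y) = exp(-(x - y)² / σ²)` on `ℝ`. Mathlib's kernels are
operator-valued; a scalar is read as the operator of multiplication by it. -/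
def gaussianKernel (𝕜 : Type*) [RCLike 𝕜] (σ : ℝ) : Matrix ℝ ℝ (𝕜 →L[𝕜] 𝕜) :=
  Matrix.of fun x y =>
    ((Real.exp (-(x - y) ^ 2 / σ ^ 2) : ℝ) : 𝕜) • ContinuousLinearMap.id 𝕜 𝕜

open scoped ComplexOrder in
theorem gaussianKernel_posSemidef (𝕜 : Type*) [RCLike 𝕜] (σ : ℝ) :
    (gaussianKernel 𝕜 σ).PosSemidef := by
  have tfae := (RKHS.posSemidef_tfae (K := gaussianKernel 𝕜 σ)).out 0 2
  refine tfae.mpr ⟨?_, fun v => ?_⟩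
  · ext x y
    simp only [Matrix.conjTranspose_apply, gaussianKernel, Matrix.of_apply, star_smul]
    rw [show (y - x) ^ 2 = (x - y) ^ 2 by ring]
    rw [show star (ContinuousLinearMap.id 𝕜 𝕜) = ContinuousLinearMap.id 𝕜 𝕜 from
      star_one (𝕜 →L[𝕜] 𝕜)]
    simp [RCLike.real_smul_eq_coe_mul]
  · set c : ℝ := (σ ^ 2)⁻¹ with hc
    have hc0 : 0 ≤ c := by positivity
    have key : ∀ x y : ℝ, HasSum (fun n : ℕ => (2 * c) ^ n / n.factorial *
        ((Real.exp (-c * x ^ 2) * x ^ n) * (Real.exp (-c * y ^ 2) * y ^ n)))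
        (Real.exp (-(x - y) ^ 2 / σ ^ 2)) := by
      intro x y
      have h := (NormedSpace.expSeries_div_hasSum_exp (2 * c * x * y)).mul_left
        (Real.exp (-c * x ^ 2) * Real.exp (-c * y ^ 2))
      rw [← Real.exp_eq_exp_ℝ, ← Real.exp_add, ← Real.exp_add] at h
      convert! h using 1
      · funext n
        rw [Real.exp_add]
        simp only [mul_pow]
        ring
      · congr 1
        rw [div_eq_mul_inv, ← hc]
        ring
    have hsum : HasSum (fun n : ℕ => (2 * c) ^ n / n.factorial *
        RCLike.normSq (v.sum fun x w => ((Real.exp (-c * x ^ 2) * x ^ n : ℝ) : 𝕜) * w))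
        (RCLike.re (v.sum fun x w => v.sum fun x' w' =>
          inner 𝕜 (gaussianKernel 𝕜 σ x' x w) w')) := by
      have h : HasSum (fun n : ℕ => v.sum fun x w => v.sum fun x' w' =>
          ((2 * c) ^ n / n.factorial *
          ((Real.exp (-c * x' ^ 2) * x' ^ n) * (Real.exp (-c * x ^ 2) * x ^ n))) *
            RCLike.re (w' * star w))
          (v.sum fun x w => v.sum fun x' w' =>
            Real.exp (-(x' - x) ^ 2 / σ ^ 2) * RCLike.re (w' * star w)) := by
        refine hasSum_sum fun x _ => hasSum_sum fun x' _ => ?_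
        exact (key x' x).mul_right _
      convert! h using 1
      · funext n
        simp only [Finsupp.sum]
        have e : ∀ z : 𝕜, RCLike.normSq z = RCLike.re (z * star z) := fun z => by
          rw [RCLike.star_def, RCLike.mul_conj, RCLike.normSq_eq_def']
          norm_cast
        rw [e, star_sum, Finset.sum_mul_sum, map_sum, Finset.mul_sum, Finset.sum_comm]
        simp only [map_sum, Finset.mul_sum]
        refine Finset.sum_congr rfl fun x _ => Finset.sum_congr rfl fun x' _ => ?_
        rw [star_mul', RCLike.star_def, RCLike.conj_ofReal, mul_mul_mul_comm, ← RCLike.ofReal_mul,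
          RCLike.re_ofReal_mul]
        ring
      · simp only [Finsupp.sum, map_sum]
        refine Finset.sum_congr rfl fun x _ => Finset.sum_congr rfl fun x' _ => ?_
        simp [gaussianKernel]
        ring
    exact hsum.nonneg fun n => mul_nonneg (by positivity) (RCLike.normSq_nonneg _)

instance gaussianKernel_fact (𝕜 : Type*) [RCLike 𝕜] (σ : ℝ) :
    Fact (gaussianKernel 𝕜 σ).PosSemidef :=
  ⟨gaussianKernel_posSemidef 𝕜 σ⟩

/-- The reproducing kernel Hilbert space `H_σ` over `𝕜` generated by the Gaussian kernel `k^σ`.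
Its elements coerce to functions `ℝ → 𝕜`. -/
abbrev GaussianRKHS (𝕜 : Type*) [RCLike 𝕜] (σ : ℝ) : Type _ :=
  RKHS.OfKernel (gaussianKernel 𝕜 σ)

end

/-! Frequency space diagnoses the eigenvalues. The Gaussian kernel has the feature map
`hartleyFeature` into L²(ℝ); it is real, so one argument serves both scalar fields. Let U be the
resulting analysis operator, so that ψ(x) is the inner product of the feature at x with Uψ.
Averaging the feature at y over a Gaussian law of mean m and variance v gives the feature at m times
exp(-vω²/2). With a = e^{αt} the mean is x/a, and substituting aω for ω restores the feature at x.
Hence K^t = U* M U with (M h)(ω) = a exp(-βω²) h(aω) for some β > 0; boundedness follows.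

The features are total, so an eigenvector ψ gives M Uψ = c Uψ. For c ≠ 0 this forces |Uψ| to grow
under dilation by a at high frequencies, which is impossible in L² unless Uψ = 0
(`ae_eq_zero_of_dampedDilation_eq`).

The other two claims come from kernel functions: K^t maps the one at x to y ↦ g(e^{-αt}y - x), where
g = `smoothedGaussian` is positive and vanishes at -∞. Sending x to infinity excludes compactness;
the asymmetry in x and y excludes self-adjointness. -/

noncomputable section

open ProbabilityTheory Filter Topology
open scoped NNReal ENNReal

/-! ### Gaussian averages of trigonometric functions. -/

/-- The kernel `cas θ = cos θ + sin θ` of the Hartley transform. -/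
def cas (θ : ℝ) : ℝ := Real.cos θ + Real.sin θ

theorem continuous_cas : Continuous cas := Real.continuous_cos.add Real.continuous_sin

theorem abs_cas_le (θ : ℝ) : |cas θ| ≤ 2 := by
  have h1 := Real.abs_cos_le_one θ
  have h2 := Real.abs_sin_le_one θ
  exact (abs_add_le _ _).trans (by linarith)

theorem cas_mul_cas (x y : ℝ) : cas x * cas y = Real.cos (x - y) + Real.sin (x + y) := by
  rw [cas, cas, Real.cos_sub, Real.sin_add]
  ring

theorem integral_cexp_mul_I_gaussianReal (m : ℝ) (v : ℝ≥0) (s : ℝ) :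
    ∫ y, Complex.exp ((s * y : ℝ) * Complex.I) ∂(gaussianReal m v) =
      (Real.exp (-v * s ^ 2 / 2) : ℝ) * Complex.exp ((s * m : ℝ) * Complex.I) := by
  have h := charFun_gaussianReal (μ := m) (v := v) s
  rw [charFun_apply_real] at h
  push_cast
  rw [h, ← Complex.exp_add]
  congr 1
  ring

theorem integrable_of_continuous_of_abs_le {μ : Measure ℝ} [IsFiniteMeasure μ] {f : ℝ → ℝ}
    (hf : Continuous f) {C : ℝ} (hC : ∀ x, |f x| ≤ C) : Integrable f μ :=
  Integrable.of_bound hf.aestronglyMeasurable C (ae_of_all _ hC)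

theorem integrable_cexp_mul_I (μ : Measure ℝ) [IsFiniteMeasure μ] (s : ℝ) :
    Integrable (fun y : ℝ => Complex.exp ((s * y : ℝ) * Complex.I)) μ :=
  Integrable.of_bound (by fun_prop) 1
    (ae_of_all _ fun y => (Complex.norm_exp_ofReal_mul_I _).le)

theorem integral_cos_gaussianReal (m : ℝ) (v : ℝ≥0) (s : ℝ) :
    ∫ y, Real.cos (s * y) ∂(gaussianReal m v) =
      Real.exp (-v * s ^ 2 / 2) * Real.cos (s * m) := by
  have h := congrArg Complex.re (integral_cexp_mul_I_gaussianReal m v s)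
  rw [Complex.re_ofReal_mul, Complex.exp_ofReal_mul_I_re] at h
  rw [← h, ← RCLike.re_eq_complex_re, ← integral_re (integrable_cexp_mul_I _ s)]
  simp only [RCLike.re_eq_complex_re, Complex.exp_ofReal_mul_I_re]

theorem integral_sin_gaussianReal (m : ℝ) (v : ℝ≥0) (s : ℝ) :
    ∫ y, Real.sin (s * y) ∂(gaussianReal m v) =
      Real.exp (-v * s ^ 2 / 2) * Real.sin (s * m) := by
  have h := congrArg Complex.im (integral_cexp_mul_I_gaussianReal m v s)
  rw [Complex.im_ofReal_mul, Complex.exp_ofReal_mul_I_im] at h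
  rw [← h, ← RCLike.im_eq_complex_im, ← integral_im (integrable_cexp_mul_I _ s)]
  simp only [RCLike.im_eq_complex_im, Complex.exp_ofReal_mul_I_im]

theorem integrable_cos_mul (μ : Measure ℝ) [IsFiniteMeasure μ] (s : ℝ) :
    Integrable (fun y => Real.cos (s * y)) μ :=
  integrable_of_continuous_of_abs_le (by fun_prop) fun _ => Real.abs_cos_le_one _

theorem integrable_sin_mul (μ : Measure ℝ) [IsFiniteMeasure μ] (s : ℝ) :
    Integrable (fun y => Real.sin (s * y)) μ :=
  integrable_of_continuous_of_abs_le (by fun_prop) fun _ => Real.abs_sin_le_one _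

theorem integral_cas_gaussianReal (m : ℝ) (v : ℝ≥0) (s : ℝ) :
    ∫ y, cas (s * y) ∂(gaussianReal m v) = Real.exp (-v * s ^ 2 / 2) * cas (s * m) := by
  simp only [cas]
  rw [integral_add (integrable_cos_mul _ s) (integrable_sin_mul _ s), integral_cos_gaussianReal,
    integral_sin_gaussianReal, mul_add]

/-! ### Hartley features: Gram kernel, totality, Gaussian averaging. -/

/-- The square root of the centred Gaussian density of variance `s`. -/
def sqrtGaussian (s : ℝ≥0) (ω : ℝ) : ℝ := √(gaussianPDFReal 0 s ω)

theorem sqrtGaussian_eq (s : ℝ≥0) (ω : ℝ) :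
    sqrtGaussian s ω = √((√(2 * Real.pi * s))⁻¹) * Real.exp (-ω ^ 2 / (4 * s)) := by
  rw [sqrtGaussian, gaussianPDFReal_def]
  simp only
  rw [Real.sqrt_mul (by positivity), ← Real.exp_half]
  congr 2
  simp only [sub_zero]
  rw [div_div]
  ring_nf

theorem sqrtGaussian_pos {s : ℝ≥0} (hs : s ≠ 0) (ω : ℝ) : 0 < sqrtGaussian s ω :=
  Real.sqrt_pos.2 (gaussianPDFReal_pos 0 s ω hs)

theorem continuous_sqrtGaussian (s : ℝ≥0) : Continuous (sqrtGaussian s) := by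
  have : sqrtGaussian s = fun ω =>
      √((√(2 * Real.pi * s))⁻¹) * Real.exp (-ω ^ 2 / (4 * s)) := funext (sqrtGaussian_eq s)
  rw [this]
  fun_prop

theorem sqrtGaussian_mul_self (s : ℝ≥0) (ω : ℝ) :
    sqrtGaussian s ω * sqrtGaussian s ω = gaussianPDFReal 0 s ω :=
  Real.mul_self_sqrt (gaussianPDFReal_nonneg 0 s ω)

theorem memLp_sqrtGaussian (s : ℝ≥0) : MemLp (sqrtGaussian s) 2 := by
  rw [memLp_two_iff_integrable_sq (continuous_sqrtGaussian s).aestronglyMeasurable]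
  simp only [sq, sqrtGaussian_mul_self]
  exact integrable_gaussianPDFReal 0 s

/-- The Hartley feature of the point `x`: it is square integrable, and inner products of features
are values of the Gaussian kernel. -/
def hartleyFeature (s : ℝ≥0) (x ω : ℝ) : ℝ := sqrtGaussian s ω * cas (ω * x)

theorem continuous_uncurry_hartleyFeature (s : ℝ≥0) :
    Continuous fun z : ℝ × ℝ => hartleyFeature s z.1 z.2 :=
  ((continuous_sqrtGaussian s).comp continuous_snd).mul
    (continuous_cas.comp (continuous_snd.mul continuous_fst))

theorem continuous_hartleyFeature (s : ℝ≥0) (x : ℝ) : Continuous (hartleyFeature s x) :=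
  (continuous_sqrtGaussian s).mul (continuous_cas.comp (continuous_id.mul continuous_const))

theorem abs_hartleyFeature_le (s : ℝ≥0) (x ω : ℝ) :
    |hartleyFeature s x ω| ≤ 2 * sqrtGaussian s ω := by
  have h0 : 0 ≤ sqrtGaussian s ω := Real.sqrt_nonneg _
  rw [hartleyFeature, abs_mul, abs_of_nonneg h0, mul_comm]
  exact mul_le_mul_of_nonneg_right (abs_cas_le _) h0

theorem memLp_hartleyFeature (s : ℝ≥0) (x : ℝ) : MemLp (hartleyFeature s x) 2 :=
  ((memLp_sqrtGaussian s).const_mul 2).mono (continuous_hartleyFeature s x).aestronglyMeasurable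
    (ae_of_all _ fun ω => (abs_hartleyFeature_le s x ω).trans (le_abs_self _))

/-- By `cas_mul_cas` the integrand is a centred Gaussian density times a cosine in x - y plus a sine
in x + y. The sine averages to zero; the cosine gives the characteristic function. -/
theorem integral_hartleyFeature_mul {s : ℝ≥0} (hs : s ≠ 0) (x y : ℝ) :
    ∫ ω, hartleyFeature s x ω * hartleyFeature s y ω = Real.exp (-s * (x - y) ^ 2 / 2) := by
  have h1 : ∀ ω, hartleyFeature s x ω * hartleyFeature s y ω =
      gaussianPDFReal 0 s ω • (Real.cos ((x - y) * ω) + Real.sin ((x + y) * ω)) := fun ω => by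
    rw [hartleyFeature, hartleyFeature, mul_mul_mul_comm, sqrtGaussian_mul_self, cas_mul_cas,
      smul_eq_mul]
    ring_nf
  simp only [h1]
  rw [← integral_gaussianReal_eq_integral_smul hs,
    integral_add (integrable_cos_mul _ _) (integrable_sin_mul _ _), integral_cos_gaussianReal,
    integral_sin_gaussianReal]
  simp

/-- Square integrable functions orthogonal to all Hartley features vanish: real case. -/
theorem ae_eq_zero_of_integral_hartleyFeature_mul {s : ℝ≥0} (hs : s ≠ 0) {u : ℝ → ℝ}
    (hu : MemLp u 2) (h : ∀ x, ∫ ω, hartleyFeature s x ω * u ω = 0) : u =ᵐ[volume] 0 := by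
  set g : ℝ → ℝ := fun ω => sqrtGaussian s ω * u ω with hg
  have hgi : Integrable g := (memLp_sqrtGaussian s).integrable_mul hu
  have hcos : ∀ x, Integrable fun ω => Real.cos (x * ω) * g ω := fun x =>
    hgi.bdd_mul (c := 1) (by fun_prop) (ae_of_all _ fun ω => Real.abs_cos_le_one _)
  have hsin : ∀ x, Integrable fun ω => Real.sin (x * ω) * g ω := fun x =>
    hgi.bdd_mul (c := 1) (by fun_prop) (ae_of_all _ fun ω => Real.abs_sin_le_one _)
  have hadd : ∀ x, (∫ ω, Real.cos (x * ω) * g ω) + ∫ ω, Real.sin (x * ω) * g ω = 0 := fun x => by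
    rw [← integral_add (hcos x) (hsin x), ← h x]
    refine integral_congr_ae (ae_of_all _ fun ω => ?_)
    simp only [hg, hartleyFeature, cas, mul_comm ω x]
    ring
  -- Replacing x by -x flips only the sine, so the cosine and sine transforms of `g` vanish
  -- separately.
  have hsub : ∀ x, (∫ ω, Real.cos (x * ω) * g ω) - ∫ ω, Real.sin (x * ω) * g ω = 0 := fun x => by
    have := hadd (-x)
    simpa [neg_mul, integral_neg, sub_eq_add_neg] using this
  have hexp : ∀ x : ℝ, Integrable fun ω : ℝ => g ω • Complex.exp (x * ω * Complex.I) := fun x => by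
    refine hgi.smul_bdd 1 (by fun_prop) (ae_of_all _ fun ω => ?_)
    rw [← Complex.ofReal_mul, Complex.norm_exp_ofReal_mul_I]
  have hzero : ∀ x : ℝ, ∫ ω : ℝ, g ω • Complex.exp (x * ω * Complex.I) = 0 := fun x => by
    apply Complex.ext
    · rw [← RCLike.re_eq_complex_re, ← integral_re (hexp x)]
      simp only [RCLike.re_eq_complex_re, Complex.smul_re, ← Complex.ofReal_mul,
        Complex.exp_ofReal_mul_I_re, smul_eq_mul, Complex.zero_re]
      simp only [mul_comm (g _)]
      linarith [hadd x, hsub x]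
    · rw [← RCLike.im_eq_complex_im, ← integral_im (hexp x)]
      simp only [RCLike.im_eq_complex_im, Complex.smul_im, ← Complex.ofReal_mul,
        Complex.exp_ofReal_mul_I_im, smul_eq_mul, Complex.zero_im]
      simp only [mul_comm (g _)]
      linarith [hadd x, hsub x]
  have hgm : AEMeasurable g := hgi.aestronglyMeasurable.aemeasurable
  have := isFiniteMeasure_withDensity_ofReal hgi.2
  have := isFiniteMeasure_withDensity_ofReal hgi.neg.2
  have hchar : ∀ {f : ℝ → ℝ}, Integrable f → ∀ x,
      charFun (volume.withDensity fun ω => ENNReal.ofReal (f ω)) x =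
        ∫ ω : ℝ, max (f ω) 0 • Complex.exp (x * ω * Complex.I) := fun {f} hf x => by
    rw [charFun_apply_real, integral_withDensity_eq_integral_toReal_smul₀
      hf.aestronglyMeasurable.aemeasurable.ennreal_ofReal
      (ae_of_all _ fun _ => ENNReal.ofReal_lt_top)]
    simp only [ENNReal.toReal_ofReal']
  -- `ENNReal.ofReal` truncates at 0, so these are the measures with densities g⁺ and g⁻. Their
  -- characteristic functions differ by the Fourier transform of `g`, which is zero.
  have hmeas : (volume.withDensity fun ω => ENNReal.ofReal (g ω)) =
      volume.withDensity fun ω => ENNReal.ofReal ((-g) ω) := by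
    apply Measure.ext_of_charFun
    funext x
    rw [hchar hgi, hchar hgi.neg, ← sub_eq_zero, ← integral_sub, ← hzero x]
    · refine integral_congr_ae (ae_of_all _ fun ω => ?_)
      simp only [← sub_smul, Pi.neg_apply]
      congr 1
      rw [max_zero_sub_max_neg_zero_eq_self]
    · refine hgi.pos_part.smul_bdd 1 (by fun_prop) (ae_of_all _ fun ω => ?_)
      rw [← Complex.ofReal_mul, Complex.norm_exp_ofReal_mul_I]
    · refine hgi.neg.pos_part.smul_bdd 1 (by fun_prop) (ae_of_all _ fun ω => ?_)
      rw [← Complex.ofReal_mul, Complex.norm_exp_ofReal_mul_I]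
  have hae := (withDensity_eq_iff hgm.ennreal_ofReal hgm.neg.ennreal_ofReal
    hgi.lintegral_lt_top.ne).1 hmeas
  filter_upwards [hae] with ω hω
  have hg0 : g ω = 0 := by
    have := congrArg ENNReal.toReal hω
    simp only [ENNReal.toReal_ofReal', Pi.neg_apply] at this
    rw [← max_zero_sub_max_neg_zero_eq_self (g ω), this, sub_self]
  exact (mul_eq_zero.1 hg0).resolve_left (sqrtGaussian_pos hs ω).ne'

variable {𝕜 : Type*} [RCLike 𝕜]

theorem integrable_hartleyFeature_smul (s : ℝ≥0) (x : ℝ) {h : ℝ → 𝕜} (hh : MemLp h 2) :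
    Integrable fun ω => hartleyFeature s x ω • h ω :=
  memLp_one_iff_integrable.1 (hh.smul (memLp_hartleyFeature s x))

/-- Square integrable functions orthogonal to all Hartley features vanish. -/
theorem ae_eq_zero_of_integral_hartleyFeature_smul {s : ℝ≥0} (hs : s ≠ 0) {h : ℝ → 𝕜}
    (hh : MemLp h 2) (h0 : ∀ x, ∫ ω, hartleyFeature s x ω • h ω = 0) : h =ᵐ[volume] 0 := by
  have hre := ae_eq_zero_of_integral_hartleyFeature_mul hs hh.re fun x => by
    have := congrArg RCLike.re (h0 x)
    rw [← integral_re (integrable_hartleyFeature_smul s x hh)] at this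
    simpa [RCLike.smul_re] using this
  have him := ae_eq_zero_of_integral_hartleyFeature_mul hs hh.im fun x => by
    have := congrArg RCLike.im (h0 x)
    rw [← integral_im (integrable_hartleyFeature_smul s x hh)] at this
    simpa [RCLike.smul_im] using this
  filter_upwards [hre, him] with ω h1 h2
  exact RCLike.ext (by simpa using h1) (by simpa using h2)

/-- Integrating the Hartley features against a Gaussian measure damps the frequencies. -/
theorem integrable_and_integral_integral_hartleyFeature_smul (s : ℝ≥0) {h : ℝ → 𝕜}
    (hh : MemLp h 2) (m : ℝ) (v : ℝ≥0) :
    Integrable (fun y => ∫ ω, hartleyFeature s y ω • h ω) (gaussianReal m v) ∧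
      ∫ y, (∫ ω, hartleyFeature s y ω • h ω) ∂(gaussianReal m v) =
        ∫ ω, (Real.exp (-v * ω ^ 2 / 2) * hartleyFeature s m ω) • h ω := by
  -- Fubini applies: the bound 2 `sqrtGaussian` |h| does not depend on y and is a product of two L²
  -- functions.
  have hp : Integrable (Function.uncurry fun y ω : ℝ => hartleyFeature s y ω • h ω)
      ((gaussianReal m v).prod volume) := by
    have hb : Integrable fun ω => (2 * sqrtGaussian s ω) • h ω :=
      memLp_one_iff_integrable.1 (hh.smul ((memLp_sqrtGaussian s).const_mul 2))
    refine (hb.comp_snd (gaussianReal m v)).mono ?_ (ae_of_all _ fun z => ?_)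
    · exact (continuous_uncurry_hartleyFeature s).aestronglyMeasurable.smul
        hh.aestronglyMeasurable.comp_snd
    · simp only [Function.uncurry, norm_smul, Real.norm_eq_abs]
      exact mul_le_mul_of_nonneg_right ((abs_hartleyFeature_le s _ _).trans (le_abs_self _))
        (norm_nonneg _)
  refine ⟨hp.integral_prod_left, ?_⟩
  rw [integral_integral_swap hp]
  refine integral_congr_ae (ae_of_all _ fun ω => ?_)
  simp only
  rw [integral_smul_const]
  congr 1
  simp only [hartleyFeature]
  rw [integral_const_mul, integral_cas_gaussianReal]
  ring

/-! ### The analysis operator of a feature map. -/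

/-- A feature map of the kernel of a scalar reproducing kernel Hilbert space induces a bounded
analysis operator that takes kernel functions to features. -/
theorem RKHS.exists_analysis {H X F : Type*} [NormedAddCommGroup H] [InnerProductSpace 𝕜 H]
    [CompleteSpace H] [RKHS 𝕜 H X 𝕜] [NormedAddCommGroup F] [InnerProductSpace 𝕜 F]
    [CompleteSpace F] (Φ : X → F)
    (hΦ : ∀ x y, RKHS.kernel H x y 1 = inner 𝕜 (Φ x) (Φ y)) :
    ∃ U : H →L[𝕜] F, (∀ x, U (RKHS.kerFun H x 1) = Φ x) ∧ ∀ ψ x, inner 𝕜 (Φ x) (U ψ) = ψ x := by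
  set k : X → H := fun x => RKHS.kerFun H x 1 with hk
  have hkk : ∀ x y, inner 𝕜 (k x) (k y) = inner 𝕜 (Φ x) (Φ y) := fun x y => by
    rw [hk, ← hΦ, RKHS.kerFun_inner, RKHS.kerFun_apply]
    simp
  set e : (X →₀ 𝕜) →ₗ[𝕜] H := Finsupp.linearCombination 𝕜 k with he
  set f : (X →₀ 𝕜) →ₗ[𝕜] F := Finsupp.linearCombination 𝕜 Φ with hf
  -- Equal Gram matrices make e v ↦ f v well defined and isometric on the span of the kernel
  -- functions, which is dense.
  have hnorm : ∀ v, ‖f v‖ = ‖e v‖ := fun v => by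
    have h : inner 𝕜 (f v) (f v) = inner 𝕜 (e v) (e v) := by
      simp only [he, hf, Finsupp.linearCombination_apply, Finsupp.sum, sum_inner, inner_sum,
        inner_smul_left, inner_smul_right, hkk]
    rw [inner_self_eq_norm_sq_to_K, inner_self_eq_norm_sq_to_K] at h
    exact (sq_eq_sq₀ (norm_nonneg _) (norm_nonneg _)).1 (by exact_mod_cast h)
  have hdense : DenseRange e := by
    have h : (LinearMap.range e).topologicalClosure = ⊤ := by
      rw [eq_top_iff, ← RKHS.kerFun_dense (H := H) (𝕜 := 𝕜) (X := X) (V := 𝕜)]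
      refine Submodule.topologicalClosure_mono (Submodule.span_le.2 ?_)
      rintro _ ⟨x, v, rfl⟩
      refine ⟨Finsupp.single x v, ?_⟩
      rw [he, Finsupp.linearCombination_single, hk, ← map_smul, smul_eq_mul, mul_one]
    have h2 := (Submodule.dense_iff_topologicalClosure_eq_top).2 h
    rwa [DenseRange, ← LinearMap.coe_range]
  have hb : ∃ C : ℝ, ∀ v, ‖f v‖ ≤ C * ‖e v‖ := ⟨1, fun v => by rw [hnorm, one_mul]⟩
  have hU : ∀ x, f.extendOfNorm e (k x) = Φ x := fun x => by
    have := LinearMap.extendOfNorm_eq hdense hb (Finsupp.single x 1)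
    simpa [he, hf] using this
  refine ⟨f.extendOfNorm e, hU, fun ψ x => ?_⟩
  induction ψ using hdense.induction_on with
  | hp => exact isClosed_eq (by fun_prop) (RKHS.continuous_eval x)
  | ih v =>
    rw [LinearMap.extendOfNorm_eq hdense hb]
    have : (e v) x = inner 𝕜 (k x) (e v) := by simp [hk]
    rw [this]
    simp only [he, hf, Finsupp.linearCombination_apply, Finsupp.sum, inner_sum, inner_smul_right,
      hkk]

/-! ### Damped dilations on L²(ℝ). -/

theorem eLpNorm_comp_mul_left_le {a : ℝ} (ha : 0 < a) {h : ℝ → 𝕜} (hh : MemLp h 2) :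
    MemLp (fun ω => h (a * ω)) 2 ∧
      eLpNorm (fun ω => h (a * ω)) 2 volume =
        (ENNReal.ofReal |a⁻¹|) ^ (1 / 2 : ℝ) * eLpNorm h 2 volume := by
  have hmap := Real.map_volume_mul_left ha.ne'
  have hh' : MemLp h 2 (Measure.map (fun x => a * x) volume) := by
    rw [hmap]
    exact hh.smul_measure ENNReal.ofReal_ne_top
  have hm : AEMeasurable (fun x : ℝ => a * x) := by fun_prop
  refine ⟨hh'.comp_of_map hm, ?_⟩
  have := eLpNorm_map_measure hh'.aestronglyMeasurable hm (p := 2)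
  rw [Function.comp_def] at this
  rw [← this, hmap, eLpNorm_smul_measure_of_ne_top (by simp)]
  simp

/-- The damped dilation `h ↦ a exp(-β ω²) h(a ω)` is a bounded operator on `L²(ℝ)`. -/
theorem exists_dampedDilation {a β : ℝ} (ha : 0 < a) (hβ : 0 ≤ β) :
    ∃ M : Lp 𝕜 2 (volume : Measure ℝ) →L[𝕜] Lp 𝕜 2 (volume : Measure ℝ),
      ∀ h : Lp 𝕜 2 (volume : Measure ℝ),
        M h =ᵐ[volume] fun ω => (a * Real.exp (-β * ω ^ 2)) • h (a * ω) := by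
  have hbound : ∀ (h : ℝ → 𝕜) (ω : ℝ),
      ‖(a * Real.exp (-β * ω ^ 2)) • h (a * ω)‖ ≤ a * ‖h (a * ω)‖ := fun h ω => by
    rw [norm_smul, Real.norm_of_nonneg (by positivity)]
    refine mul_le_mul_of_nonneg_right (mul_le_of_le_one_right ha.le ?_) (norm_nonneg _)
    rw [Real.exp_le_one_iff]
    nlinarith [sq_nonneg ω]
  have hmem : ∀ h : Lp 𝕜 2 (volume : Measure ℝ),
      MemLp (fun ω => (a * Real.exp (-β * ω ^ 2)) • h (a * ω)) 2 volume := fun h => by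
    have h1 := (eLpNorm_comp_mul_left_le ha (Lp.memLp h)).1
    refine h1.of_le_mul (c := a) ?_ (ae_of_all _ (hbound h))
    exact (by fun_prop : Continuous fun ω : ℝ => a * Real.exp (-β * ω ^ 2)).aestronglyMeasurable.smul
      h1.aestronglyMeasurable
  have hq : Measure.QuasiMeasurePreserving (fun ω : ℝ => a * ω) :=
    ⟨by fun_prop, by
      rw [Real.map_volume_mul_left ha.ne']
      exact Measure.smul_absolutelyContinuous⟩
  let L : Lp 𝕜 2 (volume : Measure ℝ) →ₗ[𝕜] Lp 𝕜 2 (volume : Measure ℝ) :=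
    { toFun := fun h => (hmem h).toLp _
      map_add' := fun g h => by
        rw [← MemLp.toLp_add, MemLp.toLp_eq_toLp_iff]
        filter_upwards [hq.ae (Lp.coeFn_add g h)] with ω hω
        rw [hω, Pi.add_apply, Pi.add_apply, smul_add]
      map_smul' := fun c h => by
        rw [RingHom.id_apply, ← MemLp.toLp_const_smul, MemLp.toLp_eq_toLp_iff]
        filter_upwards [hq.ae (Lp.coeFn_smul c h)] with ω hω
        rw [hω, Pi.smul_apply, Pi.smul_apply, smul_comm] }
  refine ⟨L.mkContinuous (a * (ENNReal.ofReal |a⁻¹| ^ (1 / 2 : ℝ)).toReal) fun h => ?_,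
    fun h => (hmem h).coeFn_toLp⟩
  change ‖(hmem h).toLp _‖ ≤ _
  rw [Lp.norm_toLp, Lp.norm_def, mul_assoc, ← ENNReal.toReal_mul,
    ← (eLpNorm_comp_mul_left_le ha (Lp.memLp h)).2]
  have h1 := (eLpNorm_comp_mul_left_le ha (Lp.memLp h)).1
  have h2 := eLpNorm_le_mul_eLpNorm_of_ae_le_mul (p := 2) (ae_of_all volume (hbound h))
  refine (ENNReal.toReal_mono (ENNReal.mul_ne_top ENNReal.ofReal_ne_top h1.2.ne) h2).trans ?_
  rw [ENNReal.toReal_mul, ENNReal.toReal_ofReal ha.le]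

theorem ae_comp_mul_left {a : ℝ} (ha : a ≠ 0) {p : ℝ → Prop} (h : ∀ᵐ ω : ℝ, p ω) :
    ∀ᵐ ω : ℝ, p (a * ω) :=
  Measure.QuasiMeasurePreserving.ae ⟨by fun_prop, by
    rw [Real.map_volume_mul_left ha]
    exact Measure.smul_absolutelyContinuous⟩ h

/-- The damped dilation has no square integrable eigenfunctions. -/
theorem ae_eq_zero_of_dampedDilation_eq {a β : ℝ} (ha : 1 < a) (hβ : 0 < β) {h : ℝ → 𝕜}
    (hh : MemLp h 2) (c : 𝕜)
    (heq : ∀ᵐ ω : ℝ, (a * Real.exp (-β * ω ^ 2)) • h (a * ω) = c * h ω) :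
    h =ᵐ[volume] 0 := by
  have ha0 : 0 < a := one_pos.trans ha
  rcases eq_or_ne c 0 with rfl | hc
  · filter_upwards [ae_comp_mul_left (inv_ne_zero ha0.ne') heq] with ω hω
    rw [mul_inv_cancel_left₀ ha0.ne', zero_mul] at hω
    exact (smul_eq_zero.1 hω).resolve_left (by positivity)
  have hc0 : 0 < ‖c‖ := norm_pos_iff.2 hc
  -- Beyond R the relation gives |h(aω)| ≥ 2|h(ω)|: the summand 1 ensures ω² ≥ R, and exp(βω²) ≥ βω²
  -- then yields ‖c‖ exp(βω²) ≥ 2a.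
  set R : ℝ := 2 * a / (‖c‖ * β) + 1 with hR
  have hR1 : 1 ≤ R := by
    have : 0 ≤ 2 * a / (‖c‖ * β) := by positivity
    linarith
  set S : Set ℝ := {ω | R < |ω|} with hS
  have hSm : MeasurableSet S := measurableSet_lt measurable_const (by fun_prop)
  have hF : Integrable fun ω => ‖h ω‖ ^ 2 := (memLp_two_iff_integrable_sq_norm hh.1).1 hh
  set G : ℝ → ℝ := S.indicator fun ω => ‖h ω‖ ^ 2 with hG
  have hGi : Integrable G := hF.indicator hSm
  have hG0 : ∀ ω, 0 ≤ G ω := fun ω => Set.indicator_nonneg (fun _ _ => by positivity) ω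
  have hgrow : ∀ᵐ ω : ℝ, 4 * G ω ≤ G (a * ω) := by
    filter_upwards [heq] with ω hω
    by_cases hωS : ω ∈ S
    · have hωR : R < |ω| := hωS
      have haS : a * ω ∈ S := by
        have : |ω| ≤ |a * ω| := by
          rw [abs_mul, abs_of_pos ha0]
          exact le_mul_of_one_le_left (abs_nonneg _) ha.le
        exact lt_of_lt_of_le hωR this
      rw [hG, Set.indicator_of_mem hωS, Set.indicator_of_mem haS]
      have h2 : 2 * a ≤ ‖c‖ * Real.exp (β * ω ^ 2) := by
        have h3 : R ≤ ω ^ 2 := by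
          rw [← sq_abs]
          nlinarith
        have h4 : 2 * a / (‖c‖ * β) ≤ ω ^ 2 := by linarith
        rw [div_le_iff₀ (by positivity)] at h4
        nlinarith [Real.add_one_le_exp (β * ω ^ 2)]
      have h5 := congrArg norm hω
      rw [norm_smul, Real.norm_of_nonneg (by positivity), norm_mul] at h5
      have h6 : a * ‖h (a * ω)‖ = (‖c‖ * Real.exp (β * ω ^ 2)) * ‖h ω‖ := by
        rw [mul_right_comm, ← h5, neg_mul, Real.exp_neg]
        field_simp
      have h7 : 2 * ‖h ω‖ ≤ ‖h (a * ω)‖ := by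
        refine le_of_mul_le_mul_left ?_ ha0
        rw [h6]
        nlinarith [mul_le_mul_of_nonneg_right h2 (norm_nonneg (h ω))]
      nlinarith [norm_nonneg (h ω)]
    · have : G ω = 0 := Set.indicator_of_notMem hωS _
      rw [this, mul_zero]
      exact hG0 _
  -- Growth and change of variables give 4∫G ≤ a⁻¹∫G ≤ ∫G.
  have hI : ∫ ω, G ω = 0 := by
    have h1 : ∫ ω, 4 * G ω ≤ ∫ ω, G (a * ω) :=
      integral_mono_ae (hGi.const_mul 4) (hGi.comp_mul_left' ha0.ne') hgrow
    rw [integral_const_mul, Measure.integral_comp_mul_left, smul_eq_mul,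
      abs_of_pos (inv_pos.2 ha0)] at h1
    have h2 : 0 ≤ ∫ ω, G ω := integral_nonneg hG0
    have h3 : a⁻¹ * ∫ ω, G ω ≤ ∫ ω, G ω :=
      mul_le_of_le_one_left h2 (inv_le_one_of_one_le₀ ha.le)
    linarith
  have hGz : G =ᵐ[volume] 0 := (integral_eq_zero_iff_of_nonneg hG0 hGi).1 hI
  -- Since c ≠ 0, vanishing at aω forces vanishing at ω, so the zero set spreads inwards to every ω
  -- ≠ 0.
  have hstep : ∀ n : ℕ, ∀ᵐ ω : ℝ, R < a ^ n * |ω| → h ω = 0 := fun n => by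
    induction n with
    | zero =>
      filter_upwards [hGz] with ω hω hRω
      have hωS : ω ∈ S := by simpa [hS] using hRω
      rw [hG, Set.indicator_of_mem hωS] at hω
      simpa using hω
    | succ n ih =>
      filter_upwards [ae_comp_mul_left ha0.ne' ih, heq] with ω h1 h2 hRω
      rw [h1 (by rwa [abs_mul, abs_of_pos ha0, ← mul_assoc, ← pow_succ]), smul_zero] at h2
      exact (mul_eq_zero.1 h2.symm).resolve_left hc
  have hne : ∀ᵐ ω : ℝ, ω ≠ 0 := by simp [ae_iff]
  filter_upwards [ae_all_iff.2 hstep, hne] with ω h1 h2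
  obtain ⟨n, hn⟩ := pow_unbounded_of_one_lt (R / |ω|) ha
  exact h1 n ((div_lt_iff₀ (abs_pos.2 h2)).1 hn)

/-! ### The Koopman operator as a damped dilation. -/

theorem ouPrecision_pos {α t : ℝ} (hα : 0 < α) (ht : 0 < t) : 0 < ouPrecision α t := by
  refine div_pos hα (sub_pos.2 (Real.exp_lt_one_iff.2 ?_))
  nlinarith [mul_pos hα ht]

/-- The Ornstein-Uhlenbeck transition probabilities are Gaussian. -/
theorem ouTransition_eq_gaussianReal {α t : ℝ} (hα : 0 < α) (ht : 0 < t) (x : ℝ) :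
    ouTransition α t x =
      gaussianReal (Real.exp (-α * t) * x) (1 / (2 * ouPrecision α t)).toNNReal := by
  have hc := ouPrecision_pos hα ht
  have hv : 0 < 1 / (2 * ouPrecision α t) := by positivity
  rw [gaussianReal_of_var_ne_zero _ (Real.toNNReal_pos.2 hv).ne', ouTransition]
  congr 1
  funext y
  rw [gaussianPDF, gaussianPDFReal_def, Real.coe_toNNReal _ hv.le]
  simp only
  congr 2
  · rw [← Real.sqrt_inv]
    congr 1
    field_simp
  · congr 1
    field_simp

/-- The Hartley features as elements of `L²(ℝ)`. -/
def hartleyFeatureLp (𝕜 : Type*) [RCLike 𝕜] (s : ℝ≥0) (x : ℝ) :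
    Lp 𝕜 2 (volume : Measure ℝ) :=
  (memLp_hartleyFeature s x).ofReal.toLp fun ω => (hartleyFeature s x ω : 𝕜)

theorem coeFn_hartleyFeatureLp (s : ℝ≥0) (x : ℝ) :
    hartleyFeatureLp 𝕜 s x =ᵐ[volume] fun ω => (hartleyFeature s x ω : 𝕜) :=
  MemLp.coeFn_toLp _

theorem inner_hartleyFeatureLp (s : ℝ≥0) (x : ℝ) (h : Lp 𝕜 2 (volume : Measure ℝ)) :
    inner 𝕜 (hartleyFeatureLp 𝕜 s x) h = ∫ ω, hartleyFeature s x ω • h ω := by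
  rw [L2.inner_def]
  refine integral_congr_ae ?_
  filter_upwards [coeFn_hartleyFeatureLp (𝕜 := 𝕜) s x] with ω hω
  rw [hω, RCLike.inner_apply, RCLike.conj_ofReal, RCLike.real_smul_eq_coe_mul,
    mul_comm]

theorem inner_hartleyFeatureLp_hartleyFeatureLp {s : ℝ≥0} (hs : s ≠ 0) (x y : ℝ) :
    inner 𝕜 (hartleyFeatureLp 𝕜 s x) (hartleyFeatureLp 𝕜 s y) =
      ((Real.exp (-s * (x - y) ^ 2 / 2) : ℝ) : 𝕜) := by
  rw [inner_hartleyFeatureLp, ← integral_hartleyFeature_mul hs, ← integral_ofReal]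
  refine integral_congr_ae ?_
  filter_upwards [coeFn_hartleyFeatureLp (𝕜 := 𝕜) s y] with ω hω
  rw [hω, RCLike.real_smul_eq_coe_mul, RCLike.ofReal_mul]

/-- The exponent has two sources: va²/2 is the Gaussian damping at frequency aω, and (a² - 1)/(4s)
corrects the weight `sqrtGaussian` from ω to aω. -/
theorem hartleyFeature_mul_exp {s : ℝ≥0} {v a : ℝ} (ha : a ≠ 0) (x ω : ℝ) :
    hartleyFeature s x ω *
        (a * Real.exp (-(v * a ^ 2 / 2 + (a ^ 2 - 1) / (4 * s)) * ω ^ 2)) =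
      a * (Real.exp (-v * (a * ω) ^ 2 / 2) * hartleyFeature s (a⁻¹ * x) (a * ω)) := by
  have h1 : a * ω * (a⁻¹ * x) = ω * x := by field_simp
  have h2 : Real.exp (-ω ^ 2 / (4 * s)) *
        Real.exp (-(v * a ^ 2 / 2 + (a ^ 2 - 1) / (4 * s)) * ω ^ 2) =
      Real.exp (-v * (a * ω) ^ 2 / 2) * Real.exp (-(a * ω) ^ 2 / (4 * s)) := by
    rw [← Real.exp_add, ← Real.exp_add]
    congr 1
    ring
  rw [hartleyFeature, hartleyFeature, h1, sqrtGaussian_eq, sqrtGaussian_eq]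
  linear_combination (a * √((√(2 * Real.pi * s))⁻¹) * cas (ω * x)) * h2

theorem integral_hartleyFeature_smul_dampedDilation {s : ℝ≥0} {v a : ℝ} (ha : 0 < a) (x : ℝ)
    (h : ℝ → 𝕜) :
    ∫ ω, hartleyFeature s x ω •
        (a * Real.exp (-(v * a ^ 2 / 2 + (a ^ 2 - 1) / (4 * s)) * ω ^ 2)) • h (a * ω) =
      ∫ ω, (Real.exp (-v * ω ^ 2 / 2) * hartleyFeature s (a⁻¹ * x) ω) • h ω := by
  simp only [smul_smul, hartleyFeature_mul_exp ha.ne']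
  simp only [← smul_smul a]
  rw [integral_smul, Measure.integral_comp_mul_left
    (fun ω => (Real.exp (-v * ω ^ 2 / 2) * hartleyFeature s (a⁻¹ * x) ω) • h ω), smul_smul,
    abs_of_pos (inv_pos.2 ha), mul_inv_cancel₀ ha.ne', one_smul]

theorem kernel_gaussianRKHS (σ x y : ℝ) :
    RKHS.kernel (GaussianRKHS 𝕜 σ) x y 1 = ((Real.exp (-(x - y) ^ 2 / σ ^ 2) : ℝ) : 𝕜) := by
  rw [RKHS.OfKernel.kernel_ofKernel]
  simp [gaussianKernel]

/-- The Koopman operator restricts to a bounded operator on the Gaussian reproducing kernel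
Hilbert space, and this restriction has no eigenvalues. -/
theorem exists_koopman_clm (α σ t : ℝ) (hα : 0 < α) (hσ : 0 < σ) (ht : 0 < t) :
    ∃ T : GaussianRKHS 𝕜 σ →L[𝕜] GaussianRKHS 𝕜 σ,
      (∀ (ψ : GaussianRKHS 𝕜 σ) (x : ℝ),
        Integrable (fun y : ℝ => ψ y) (ouTransition α t x) ∧
          (T ψ) x = ouKoopman α t (fun y : ℝ => ψ y) x) ∧
      ∀ (c : 𝕜) (ψ : GaussianRKHS 𝕜 σ), T ψ = c • ψ → ψ = 0 := by
  -- This variance makes exp(-s(x - y)²/2) the Gaussian kernel of scale σ.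
  set s : ℝ≥0 := (2 / σ ^ 2).toNNReal with hs
  have hspos : 0 < 2 / σ ^ 2 := by positivity
  have hs0 : s ≠ 0 := (Real.toNNReal_pos.2 hspos).ne'
  have hsc : (s : ℝ) = 2 / σ ^ 2 := Real.coe_toNNReal _ hspos.le
  set v : ℝ≥0 := (1 / (2 * ouPrecision α t)).toNNReal with hv
  have hv0 : (0 : ℝ) < v := by
    have := ouPrecision_pos hα ht
    exact NNReal.coe_pos.2 (Real.toNNReal_pos.2 (by positivity))
  set a : ℝ := Real.exp (α * t) with ha
  have ha1 : 1 < a := Real.one_lt_exp_iff.2 (mul_pos hα ht)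
  have ha0 : 0 < a := one_pos.trans ha1
  have hainv : Real.exp (-α * t) = a⁻¹ := by rw [ha, ← Real.exp_neg, neg_mul]
  have hs0' : (0 : ℝ) < s := by rwa [hsc]
  have hβ : 0 < v * a ^ 2 / 2 + (a ^ 2 - 1) / (4 * s) := by
    have : 0 < a ^ 2 - 1 := by nlinarith
    positivity
  obtain ⟨U, hUk, hU⟩ := RKHS.exists_analysis (H := GaussianRKHS 𝕜 σ) (hartleyFeatureLp 𝕜 s)
    fun x y => by
      rw [kernel_gaussianRKHS, inner_hartleyFeatureLp_hartleyFeatureLp hs0, hsc]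
      congr 2
      field_simp
  obtain ⟨M, hM⟩ := exists_dampedDilation (𝕜 := 𝕜) ha0 hβ.le
  have hadj : ∀ f x, (U.adjoint f) x = inner 𝕜 (hartleyFeatureLp 𝕜 s x) f := fun f x => by
    rw [← hUk, ← ContinuousLinearMap.adjoint_inner_right, RKHS.kerFun_inner]
    simp
  have hψ : ∀ (ψ : GaussianRKHS 𝕜 σ) y, ψ y = ∫ ω, hartleyFeature s y ω • U ψ ω := fun ψ y => by
    rw [← inner_hartleyFeatureLp, hU]
  refine ⟨U.adjoint ∘L M ∘L U, fun ψ x => ?_, fun c ψ hcψ => ?_⟩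
  · rw [ouKoopman, ouTransition_eq_gaussianReal hα ht]
    simp only [hψ ψ]
    have hint := integrable_and_integral_integral_hartleyFeature_smul s (Lp.memLp (U ψ))
      (Real.exp (-α * t) * x) v
    refine ⟨hint.1, ?_⟩
    rw [hint.2, hainv, ← integral_hartleyFeature_smul_dampedDilation ha0]
    simp only [ContinuousLinearMap.comp_apply]
    rw [hadj, inner_hartleyFeatureLp]
    refine integral_congr_ae ?_
    filter_upwards [hM (U ψ)] with ω hω
    rw [hω]
  -- Paired with the feature at x, the difference gives (Tψ)(x) - cψ(x) = 0; totality of the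
  -- features concludes.
  · have hMU : M (U ψ) - c • U ψ = 0 := by
      rw [Lp.eq_zero_iff_ae_eq_zero]
      refine ae_eq_zero_of_integral_hartleyFeature_smul hs0 (Lp.memLp _) fun x => ?_
      rw [← inner_hartleyFeatureLp, inner_sub_right, inner_smul_right, hU, ← hadj]
      have := congrArg (fun f : GaussianRKHS 𝕜 σ => f x) hcψ
      simpa [sub_eq_zero] using this
    have hU0 : U ψ =ᵐ[volume] 0 := by
      refine ae_eq_zero_of_dampedDilation_eq ha1 hβ (Lp.memLp _) c ?_
      have h1 := Lp.coeFn_smul c (U ψ)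
      rw [← sub_eq_zero.1 hMU] at h1
      filter_upwards [hM (U ψ), h1] with ω h2 h3
      rw [← h2, h3, Pi.smul_apply, smul_eq_mul]
    have hU0' : U ψ = 0 := Lp.eq_zero_iff_ae_eq_zero.2 hU0
    refine RKHS.ext fun x => ?_
    rw [← hU, hU0', inner_zero_right, RKHS.coe_zero, Pi.zero_apply]

/-! ### Action on kernel functions: failure of compactness and self-adjointness. -/

/-- The Gaussian function of scale `σ`, averaged over a centred Gaussian measure of variance `v`
and translated by `x`. -/
def smoothedGaussian (σ : ℝ) (v : ℝ≥0) (x : ℝ) : ℝ :=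
  ∫ z, Real.exp (-(z + x) ^ 2 / σ ^ 2) ∂(gaussianReal 0 v)

theorem abs_exp_neg_sq_div_le_one (σ z : ℝ) : |Real.exp (-z ^ 2 / σ ^ 2)| ≤ 1 := by
  rw [abs_of_pos (Real.exp_pos _), Real.exp_le_one_iff, neg_div, neg_nonpos]
  positivity

theorem smoothedGaussian_pos (σ : ℝ) (v : ℝ≥0) (x : ℝ) : 0 < smoothedGaussian σ v x :=
  integral_exp_pos (integrable_of_continuous_of_abs_le (by fun_prop) fun _ =>
    abs_exp_neg_sq_div_le_one σ _)

theorem tendsto_smoothedGaussian_atBot {σ : ℝ} (hσ : 0 < σ) (v : ℝ≥0) :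
    Tendsto (smoothedGaussian σ v) atBot (𝓝 0) := by
  have h0 : (0 : ℝ) = ∫ _, 0 ∂(gaussianReal 0 v) := by simp
  rw [h0]
  refine tendsto_integral_filter_of_dominated_convergence (fun _ => 1)
    (Eventually.of_forall fun x => by fun_prop)
    (Eventually.of_forall fun x => ae_of_all _ fun z => abs_exp_neg_sq_div_le_one σ _)
    (integrable_const _) (ae_of_all _ fun z => ?_)
  have h1 : Tendsto (fun x : ℝ => (z + x) ^ 2 / σ ^ 2) atBot atTop := by
    refine Tendsto.atTop_div_const (by positivity) ?_
    simp only [← sq_abs (z + _)]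
    exact (tendsto_pow_atTop two_ne_zero).comp
      (tendsto_abs_atBot_atTop.comp (tendsto_atBot_add_const_left _ z tendsto_id))
  refine (Real.tendsto_exp_neg_atTop_nhds_zero.comp h1).congr fun x => ?_
  rw [Function.comp_apply, neg_div]

/-- The Koopman operator maps kernel functions to translates and dilates of one Gaussian. -/
theorem ouKoopman_kerFun {α σ t : ℝ} (hα : 0 < α) (ht : 0 < t) (x y : ℝ) :
    ouKoopman α t (fun z => RKHS.kerFun (GaussianRKHS 𝕜 σ) x (1 : 𝕜) z) y =
      (smoothedGaussian σ (1 / (2 * ouPrecision α t)).toNNReal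
        (Real.exp (-α * t) * y - x) : ℝ) := by
  simp only [ouKoopman, ouTransition_eq_gaussianReal hα ht, RKHS.kerFun_apply, kernel_gaussianRKHS]
  rw [integral_ofReal, smoothedGaussian]
  congr 1
  have h := gaussianReal_map_add_const (μ := 0) (v := (1 / (2 * ouPrecision α t)).toNNReal)
    (Real.exp (-α * t) * y)
  rw [zero_add] at h
  rw [← h, integral_map (by fun_prop)
    (by fun_prop : Continuous fun z => Real.exp (-(z - x) ^ 2 / σ ^ 2)).aestronglyMeasurable]
  simp only [add_sub_assoc]

theorem norm_kerFun_gaussianRKHS (σ x : ℝ) :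
    ‖RKHS.kerFun (GaussianRKHS 𝕜 σ) x (1 : 𝕜)‖ = 1 := by
  have h : inner 𝕜 (RKHS.kerFun (GaussianRKHS 𝕜 σ) x (1 : 𝕜))
      (RKHS.kerFun (GaussianRKHS 𝕜 σ) x (1 : 𝕜)) = 1 := by
    rw [RKHS.kerFun_inner, RKHS.kerFun_apply, kernel_gaussianRKHS]
    simp
  rw [inner_self_eq_norm_sq_to_K] at h
  have h2 : ‖RKHS.kerFun (GaussianRKHS 𝕜 σ) x (1 : 𝕜)‖ ^ 2 = 1 := by exact_mod_cast h
  exact (pow_eq_one_iff_of_nonneg (norm_nonneg _) two_ne_zero).1 h2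

theorem norm_apply_le_norm_gaussianRKHS {σ : ℝ} (f : GaussianRKHS 𝕜 σ) (x : ℝ) :
    ‖f x‖ ≤ ‖f‖ := by
  have h := norm_inner_le_norm (𝕜 := 𝕜) (RKHS.kerFun (GaussianRKHS 𝕜 σ) x (1 : 𝕜)) f
  rw [norm_kerFun_gaussianRKHS, one_mul, RKHS.kerFun_inner] at h
  simpa using h

/-- The images of the unit vectors k_n tend to 0 pointwise, so 0 is their only possible norm limit
along a subsequence; yet their norms stay above a positive constant. -/
theorem not_isCompactOperator_of_koopman {α σ t : ℝ} (hα : 0 < α) (hσ : 0 < σ) (ht : 0 < t)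
    (T : GaussianRKHS 𝕜 σ →L[𝕜] GaussianRKHS 𝕜 σ)
    (hT : ∀ (ψ : GaussianRKHS 𝕜 σ) (x : ℝ), (T ψ) x = ouKoopman α t (fun y : ℝ => ψ y) x) :
    ¬ IsCompactOperator T := by
  intro hc
  set v : ℝ≥0 := (1 / (2 * ouPrecision α t)).toNNReal
  set b : ℝ := Real.exp (-α * t) with hb
  have hb0 : 0 < b := Real.exp_pos _
  set k : ℕ → GaussianRKHS 𝕜 σ := fun n => RKHS.kerFun (GaussianRKHS 𝕜 σ) (n : ℝ) (1 : 𝕜)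
  have hTk : ∀ n y, (T (k n)) y = (smoothedGaussian σ v (b * y - n) : ℝ) := fun n y => by
    rw [hT, ouKoopman_kerFun hα ht]
  obtain ⟨K, hK, hsub⟩ := IsCompactOperator.image_closedBall_subset_compact
    (f := (T : GaussianRKHS 𝕜 σ →ₗ[𝕜] GaussianRKHS 𝕜 σ)) hc 1
  have hmem : ∀ n, T (k n) ∈ K := fun n => hsub ⟨k n, by
    rw [mem_closedBall_zero_iff, norm_kerFun_gaussianRKHS], rfl⟩
  obtain ⟨g, -, φ, hφ, hlim⟩ := hK.tendsto_subseq hmem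
  have hg : g = 0 := by
    refine RKHS.ext fun y => ?_
    rw [RKHS.coe_zero, Pi.zero_apply]
    have h1 : Tendsto (fun n => (T (k (φ n))) y) atTop (𝓝 (g y)) :=
      ((RKHS.continuous_eval y).tendsto g).comp hlim
    refine tendsto_nhds_unique h1 ?_
    simp only [hTk]
    rw [← RCLike.ofReal_zero (K := 𝕜)]
    refine (RCLike.continuous_ofReal.tendsto 0).comp
      ((tendsto_smoothedGaussian_atBot hσ v).comp ?_)
    simp only [sub_eq_add_neg]
    exact tendsto_atBot_add_const_left _ _ (tendsto_neg_atTop_atBot.comp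
      (tendsto_natCast_atTop_atTop.comp hφ.tendsto_atTop))
  -- The norm dominates point values; b⁻¹n is the point where the argument by - n is zero.
  have hnorm : ∀ n, smoothedGaussian σ v 0 ≤ ‖T (k n)‖ := fun n => by
    refine le_trans ?_ (norm_apply_le_norm_gaussianRKHS (T (k n)) (b⁻¹ * n))
    rw [hTk, RCLike.norm_ofReal, mul_inv_cancel_left₀ hb0.ne', sub_self]
    exact le_abs_self _
  have h2 : Tendsto (fun n => ‖T (k (φ n))‖) atTop (𝓝 0) := by
    rw [hg] at hlim
    simpa using hlim.norm
  exact absurd (ge_of_tendsto' h2 fun n => hnorm (φ n)) (smoothedGaussian_pos σ v 0).not_ge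

theorem not_isSelfAdjoint_of_koopman {α σ t : ℝ} (hα : 0 < α) (hσ : 0 < σ) (ht : 0 < t)
    (T : GaussianRKHS 𝕜 σ →L[𝕜] GaussianRKHS 𝕜 σ)
    (hT : ∀ (ψ : GaussianRKHS 𝕜 σ) (x : ℝ), (T ψ) x = ouKoopman α t (fun y : ℝ => ψ y) x) :
    ¬ IsSelfAdjoint T := by
  intro hs
  set v : ℝ≥0 := (1 / (2 * ouPrecision α t)).toNNReal
  set b : ℝ := Real.exp (-α * t) with hb
  have hb0 : 0 < b := Real.exp_pos _
  have hb1 : b < 1 := Real.exp_lt_one_iff.2 (by nlinarith [mul_pos hα ht])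
  set k : ℝ → GaussianRKHS 𝕜 σ := fun x => RKHS.kerFun (GaussianRKHS 𝕜 σ) x (1 : 𝕜)
  have hTk : ∀ x y, (T (k x)) y = (smoothedGaussian σ v (b * y - x) : ℝ) := fun x y => by
    rw [hT, ouKoopman_kerFun hα ht]
  have hsymm : ∀ x y, smoothedGaussian σ v (b * x - y) = smoothedGaussian σ v (b * y - x) :=
    fun x y => by
      have h := hs.isSymmetric (k y) (k x)
      rw [ContinuousLinearMap.coe_coe, RKHS.inner_kerFun, RKHS.kerFun_inner, hTk, hTk] at h
      simpa using h
  -- Taking y = b⁻¹x freezes one side of the symmetry while, as b < 1, the other side runs to -∞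
  -- with growing x.
  have hconst : ∀ x, smoothedGaussian σ v ((b - b⁻¹) * x) = smoothedGaussian σ v 0 := fun x => by
    have h := hsymm x (b⁻¹ * x)
    rwa [mul_inv_cancel_left₀ hb0.ne', sub_self, ← sub_mul] at h
  have hneg : b - b⁻¹ < 0 := by
    have := (one_lt_inv₀ hb0).2 hb1
    linarith
  have hlim : Tendsto (fun x => smoothedGaussian σ v ((b - b⁻¹) * x)) atTop (𝓝 0) :=
    (tendsto_smoothedGaussian_atBot hσ v).comp (tendsto_id.const_mul_atTop_of_neg hneg)
  simp only [hconst] at hlim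
  exact (smoothedGaussian_pos σ v 0).ne' (tendsto_nhds_unique tendsto_const_nhds hlim)

end

theorem mainTheorem8 {𝕜 : Type*} [RCLike 𝕜] (α σ t : ℝ) (hα : 0 < α) (hσ : 0 < σ) (ht : 0 < t) :
    ∃ T : GaussianRKHS 𝕜 σ →L[𝕜] GaussianRKHS 𝕜 σ,
      (∀ (ψ : GaussianRKHS 𝕜 σ) (x : ℝ),
        Integrable (fun y : ℝ => ψ y) (ouTransition α t x) ∧
          (T ψ) x = ouKoopman α t (fun y : ℝ => ψ y) x) ∧
      (∀ c : 𝕜, ¬ Module.End.HasEigenvalue (T : GaussianRKHS 𝕜 σ →ₗ[𝕜] GaussianRKHS 𝕜 σ) c) ∧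
      ¬ IsCompactOperator T ∧
      ¬ IsSelfAdjoint T := by
  obtain ⟨T, hT, heig⟩ := exists_koopman_clm (𝕜 := 𝕜) α σ t hα hσ ht
  refine ⟨T, hT, fun c hc => ?_,
    not_isCompactOperator_of_koopman hα hσ ht T fun ψ x => (hT ψ x).2,
    not_isSelfAdjoint_of_koopman hα hσ ht T fun ψ x => (hT ψ x).2⟩
  obtain ⟨ψ, hψ⟩ := hc.exists_hasEigenvector
  exact hψ.2 (heig c ψ hψ.apply_eq_smul)
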